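/- Let $X$ be a smooth and strictly convex real normed linear space with $\dim X\ge 3$ (possibly infinite); smooth means that for every $x$ with $\|x\|=1$ there is exactly one continuous linear functional $f$ on $X$ with $\|f\|=1$ and $f(x)=1$. For a linear subspace $G\subseteq X$ and $x_0\in X$, an element $g_0\in G$ is a best approximation to $x_0$ out of $G$ if $\|x_0-g_0\|\le\|x_0-g\|$ for all $g\in G$, and an element $w_0\in G$ is a best coapproximation to $x_0$ out of $G$ if $\|w_0-g\|\le\|x_0-g\|$ for all $g\in G$. Then $X$ is an inner product space (that is, its norm is induced by an inner product) if and only if for every $x_0\in X$ and every one-dimensional subspace $G$ of $X$ the best coapproximation to $x_0$ out of $G$ exists and is equal to the best approximation to $x_0$ out of $G$, i.e. there is an element $w_0\in G$ which is both a best coapproximation and a best approximation to $x_0$ out of $G$. Moreover, when $X$ is an inner product space, for all such $x_0$ and $G$ the best coapproximation and the best approximation are each unique. -/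

import Mathlib

/-- A real normed space is smooth if at every point of its unit sphere there is exactly one
supporting functional, that is, exactly one continuous linear functional of norm one that attains
its norm at the point. -/
def IsSmoothNormedSpace (X : Type*) [NormedAddCommGroup X] [NormedSpace ℝ X] : Prop :=
  ∀ x : X, ‖x‖ = 1 → ∃! f : StrongDual ℝ X, ‖f‖ = 1 ∧ f x = 1

/-- The norm of the given real normed space comes from an inner product on the same vector
space. -/
def IsRealInnerProductSpace (X : Type*) [NormedAddCommGroup X] [hX : NormedSpace ℝ X] : Prop :=
  ∃ I : InnerProductSpace ℝ X, I.toNormedSpace = hX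

/-- `g₀` is a best approximation to `x₀` out of the subspace `G`. -/
def IsBestApproximation {X : Type*} [NormedAddCommGroup X] [NormedSpace ℝ X]
    (G : Submodule ℝ X) (x₀ g₀ : X) : Prop :=
  g₀ ∈ G ∧ ∀ g ∈ G, ‖x₀ - g₀‖ ≤ ‖x₀ - g‖

/-- `w₀` is a best coapproximation to `x₀` out of the subspace `G`. -/
def IsBestCoapproximation {X : Type*} [NormedAddCommGroup X] [NormedSpace ℝ X]
    (G : Submodule ℝ X) (x₀ w₀ : X) : Prop :=
  w₀ ∈ G ∧ ∀ g ∈ G, ‖w₀ - g‖ ≤ ‖x₀ - g‖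

/-! Write `x ⊥ y` for Birkhoff orthogonality: `‖x‖ ≤ ‖x + t • y‖` for all real `t`. If `x ⊥ y`, then
`0` is a best approximation to `x` out of the line of `y`, by strict convexity the only one; being
also a coapproximation, it gives `y ⊥ x`.

By smoothness, the vectors to which `x` is orthogonal form the kernel of one functional. On a
3-dimensional subspace, symmetry therefore gives a polarity of the projective plane. Coordinates
show that it comes from a diagonal form, since the only ring endomorphism of `ℝ` is the identity. A
planar norm whose orthogonality contains that of such a form is a multiple of its square root, so
the parallelogram law holds.

Conversely, orthogonal projection and Pythagoras give both approximations. -/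

/-! ### Polarities of the real projective plane -/

/-- A relation on `ℝ³` of the form `⟨F x, y⟩ = 0` that is symmetric, anisotropic, and for which the
standard basis is self-orthonormal, is on the plane `c = 0` the orthogonality of a positive
definite diagonal form. -/
theorem exists_diagonal_form_of_symmetric_relation (A B C : ℝ → ℝ → ℝ → ℝ)
    (hsym : ∀ a b c u v w, A a b c * u + B a b c * v + C a b c * w = 0 →
      A u v w * a + B u v w * b + C u v w * c = 0)
    (hdef : ∀ a b c, A a b c * a + B a b c * b + C a b c * c = 0 → a = 0 ∧ b = 0 ∧ c = 0)
    (h₁ : A 1 0 0 = 1 ∧ B 1 0 0 = 0 ∧ C 1 0 0 = 0)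
    (h₂ : A 0 1 0 = 0 ∧ B 0 1 0 = 1 ∧ C 0 1 0 = 0)
    (h₃ : A 0 0 1 = 0 ∧ B 0 0 1 = 0 ∧ C 0 0 1 = 1) :
    ∃ p q : ℝ, 0 < p ∧ 0 < q ∧ ∀ a b u v, p * a * u + q * b * v = 0 →
      A a b 0 * u + B a b 0 * v = 0 := by
  obtain ⟨h1A, h1B, h1C⟩ := h₁
  obtain ⟨h2A, h2B, h2C⟩ := h₂
  obtain ⟨h3A, h3B, h3C⟩ := h₃
  have hA : ∀ a b c, A a b c = 0 ↔ a = 0 := fun a b c => by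
    constructor
    · intro h; simpa [h1A, h1B, h1C] using hsym a b c 1 0 0 (by simp [h])
    · rintro rfl; simpa using hsym 1 0 0 0 b c (by simp [h1B, h1C])
  have hB : ∀ a b c, B a b c = 0 ↔ b = 0 := fun a b c => by
    constructor
    · intro h; simpa [h2A, h2B, h2C] using hsym a b c 0 1 0 (by simp [h])
    · rintro rfl; simpa using hsym 0 1 0 a 0 c (by simp [h2A, h2C])
  have hC : ∀ a b c, C a b c = 0 ↔ c = 0 := fun a b c => by
    constructor
    · intro h; simpa [h3A, h3B, h3C] using hsym a b c 0 0 1 (by simp [h])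
    · rintro rfl; simpa using hsym 0 0 1 a b 0 (by simp [h3A, h3B])
  have hA0 : ∀ b c, A 0 b c = 0 := fun b c => (hA _ _ _).2 rfl
  have hB0 : ∀ a c, B a 0 c = 0 := fun a c => (hB _ _ _).2 rfl
  have hC0 : ∀ a b, C a b 0 = 0 := fun a b => (hC _ _ _).2 rfl
  have hC1 : ∀ a b, C a b 1 ≠ 0 := fun a b h => one_ne_zero ((hC _ _ _).1 h)
  set χ : ℝ → ℝ := fun t => A t 0 1 / C t 0 1 with hχ
  set ψ : ℝ → ℝ := fun t => B 0 t 1 / C 0 t 1 with hψ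
  -- The vector `(C a 0 1, 0, -A a 0 1)` is orthogonal to `(a, 0, 1)`; its middle coordinate is
  -- zero, so its functional ignores `b`.
  have hAC : ∀ a b, A a b 1 = χ a * C a b 1 := fun a b => by
    have h := hsym _ _ _ _ _ _ (show A a 0 1 * C a 0 1 + B a 0 1 * 0 + C a 0 1 * (-A a 0 1) = 0 by
      ring)
    have h' := hsym _ _ _ a b 1 (by rw [hB0] at h ⊢; linear_combination h)
    have := hC1 a 0
    simp only [hχ]; field_simp; linear_combination h'
  have hBC : ∀ a b, B a b 1 = ψ b * C a b 1 := fun a b => by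
    have h := hsym _ _ _ _ _ _ (show A 0 b 1 * 0 + B 0 b 1 * C 0 b 1 + C 0 b 1 * (-B 0 b 1) = 0 by
      ring)
    have h' := hsym _ _ _ a b 1 (by rw [hA0] at h ⊢; linear_combination h)
    have := hC1 0 b
    simp only [hψ]; field_simp; linear_combination h'
  have hrel : ∀ a b u v w, A a b 1 * u + B a b 1 * v + C a b 1 * w = 0 ↔
      χ a * u + ψ b * v + w = 0 := fun a b u v w => by
    rw [hAC, hBC, show χ a * C a b 1 * u + ψ b * C a b 1 * v + C a b 1 * w =
      C a b 1 * (χ a * u + ψ b * v + w) by ring, mul_eq_zero, or_iff_right (hC1 a b)]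
  have hone : ∀ a b u v, χ a * u + ψ b * v + 1 = 0 → a * χ u + b * ψ v + 1 = 0 :=
    fun a b u v h => by
      have := (hrel _ _ _ _ _).1 (hsym _ _ _ _ _ _ ((hrel a b u v 1).2 h))
      linear_combination this
  have hχ0 : ∀ t, χ t = 0 ↔ t = 0 := fun t => by simp [hχ, hA, hC1]
  have hψ0 : ∀ t, ψ t = 0 ↔ t = 0 := fun t => by simp [hψ, hB, hC1]
  have hp : χ 1 ≠ 0 := fun h => one_ne_zero ((hχ0 _).1 h)
  have hq : ψ 1 ≠ 0 := fun h => one_ne_zero ((hψ0 _).1 h)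
  -- The functional of `(ψ b, -χ a, 0)` kills `(a, b, 1)` and ignores the third coordinate, so it
  -- kills `(t * a, t * b, 1)`.
  have hscale : ∀ t a b, χ (t * a) * ψ b = χ a * ψ (t * b) := fun t a b => by
    have h := hsym _ _ _ _ _ _ ((hrel a b (ψ b) (-χ a) 0).2 (by ring))
    rw [hC0] at h
    have h' := (hrel (t * a) (t * b) _ _ _).1 (hsym _ _ _ (t * a) (t * b) 1
      (by rw [hC0]; linear_combination t * h))
    linear_combination h'
  have hψχ : ∀ t, ψ t = ψ 1 * (χ t / χ 1) := fun t => by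
    have := hscale t 1 1
    simp only [mul_one] at this
    field_simp; linear_combination -this
  have hmul : ∀ s t, χ (s * t) / χ 1 = χ s / χ 1 * (χ t / χ 1) := fun s t => by
    have := hscale s t 1
    rw [mul_one, hψχ s] at this
    have := mul_right_cancel₀ hq (this.trans (by ring : _ = (χ t * χ s / χ 1) * ψ 1))
    rw [this]; field_simp
  have h11 : χ 1 / χ 1 = 1 := div_self hp
  have h00 : χ 0 / χ 1 = 0 := by simp [(hχ0 0).2 rfl]
  have hne : ∀ t, t ≠ 0 → χ t / χ 1 ≠ 0 := fun t ht => div_ne_zero (mt (hχ0 t).1 ht) hp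
  generalize hσ : (fun t => χ t / χ 1) = σ at *
  have hσt : ∀ t, χ t / χ 1 = σ t := fun t => congrFun hσ t
  have hχσ : ∀ t, χ t = χ 1 * σ t := fun t => by rw [← hσt]; field_simp
  simp only [hσt] at *
  -- The pole of the line through `(1, 0, 1)` and `(0, 1, 1)` is also orthogonal to `(t, 1 - t, 1)`.
  have hadd1 : ∀ t, σ t + σ (1 - t) = 1 := by
    have hψ00 : ψ 0 = 0 := (hψ0 0).2 rfl
    have hχ00 : χ 0 = 0 := (hχ0 0).2 rfl
    have ha := hone 1 0 (-1 / χ 1) (-1 / ψ 1) (by rw [hψ00]; field_simp; ring)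
    have hb := hone 0 1 (-1 / χ 1) (-1 / ψ 1) (by rw [hχ00]; field_simp; ring)
    intro t
    have h := hone (-1 / χ 1) (-1 / ψ 1) t (1 - t) (by linear_combination t * ha + (1 - t) * hb)
    rw [hχσ t, hψχ (1 - t)] at h
    field_simp at h
    linear_combination -h
  have hneg : σ (-1) = -1 := by
    have hsq : σ (-1) * σ (-1) = 1 := by rw [← hmul]; simpa using h11
    rcases mul_self_eq_one_iff.1 hsq with h | h
    · have h2 := hadd1 2
      norm_num [h] at h2
      exact absurd h2 (hne 2 two_ne_zero)
    · exact h
  have hadd : ∀ s t, σ (s + t) = σ s + σ t := fun s t => by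
    by_cases h : s + t = 0
    · obtain rfl : t = -1 * s := by linarith
      rw [h, hmul, hneg, h00]; ring
    · have h1 := hadd1 (s / (s + t))
      have h2 : 1 - s / (s + t) = t / (s + t) := by field_simp; ring
      have h3 : σ s = σ (s + t) * σ (s / (s + t)) := by rw [← hmul]; congr 1; field_simp
      have h4 : σ t = σ (s + t) * σ (t / (s + t)) := by rw [← hmul]; congr 1; field_simp
      rw [h2] at h1
      rw [h3, h4, ← mul_add, h1, mul_one]
  let ρ : ℝ →+* ℝ := { toFun := σ, map_one' := h11, map_mul' := hmul, map_zero' := h00,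
                        map_add' := hadd }
  have hid : ∀ t, σ t = t := fun t => by
    have : ρ = RingHom.id ℝ := Subsingleton.elim _ _
    exact congrArg (fun r : ℝ →+* ℝ => r t) this
  have hχid : ∀ t, χ t = χ 1 * t := fun t => by rw [hχσ, hid]
  have hψid : ∀ t, ψ t = ψ 1 * t := fun t => by rw [hψχ, hid]
  -- A negative coefficient would produce a nonzero self-orthogonal vector.
  have hinv : ∀ p : ℝ, p ≠ 0 → ¬ 0 < p → p * (√(-p))⁻¹ * (√(-p))⁻¹ = -1 := fun p h0 hp => by
    have hneg : 0 < -p := by rcases lt_or_gt_of_ne h0 with h | h <;> [linarith; exact absurd h hp]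
    have hs := Real.mul_self_sqrt hneg.le
    have := (Real.sqrt_pos.2 hneg).ne'
    field_simp
    linear_combination hs
  refine ⟨χ 1, ψ 1, ?_, ?_, ?_⟩
  · by_contra hle
    refine one_ne_zero (hdef (√(-χ 1))⁻¹ 0 1 ((hrel _ _ _ _ _).2 ?_)).2.2
    rw [hχid]; linear_combination hinv _ hp hle
  · by_contra hle
    refine one_ne_zero (hdef 0 (√(-ψ 1))⁻¹ 1 ((hrel _ _ _ _ _).2 ?_)).2.2
    rw [hψid]; linear_combination hinv _ hq hle
  · intro a b u v h
    have h1 := (hrel a b u v 0).2 (by rw [hχid, hψid]; linear_combination h)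
    have h2 := hsym _ _ _ _ _ _ h1
    rw [hC0] at h2
    have h3 := hsym _ _ _ a b 0 (by rw [hC0]; linear_combination h2)
    linear_combination h3

/-! ### Planar norms with elliptic orthogonality -/

/-- If rotating by `δ` decreases a function at most by the factor `|cos δ|`, the function is
constant. -/
theorem eq_of_abs_cos_mul_le (g : ℝ → ℝ) (hg : ∀ θ, 0 ≤ g θ)
    (h : ∀ θ δ, |Real.cos δ| * g θ ≤ g (θ + δ)) (θ φ : ℝ) : g θ = g φ := by
  suffices H : ∀ θ δ, g θ ≤ g (θ + δ) by
    have h1 := H θ (φ - θ)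
    have h2 := H φ (θ - φ)
    rw [add_sub_cancel] at h1 h2
    exact h1.antisymm h2
  intro θ δ
  have hiter : ∀ η : ℝ, ∀ n : ℕ, |Real.cos η| ^ n * g θ ≤ g (θ + n * η) := fun η n => by
    induction n with
    | zero => simp
    | succ n ih =>
      calc |Real.cos η| ^ (n + 1) * g θ = |Real.cos η| * (|Real.cos η| ^ n * g θ) := by ring
        _ ≤ |Real.cos η| * g (θ + n * η) := by gcongr
        _ ≤ g (θ + n * η + η) := h _ _
        _ = g (θ + (n + 1 : ℕ) * η) := by push_cast; ring_nf
  -- Split `δ` into `n` equal rotations; by Bernoulli the total loss is `O(1 / n)`.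
  have hbound : ∀ n : ℕ, 0 < n → (1 - δ ^ 2 / 2 * (n : ℝ)⁻¹) * g θ ≤ g (θ + δ) := fun n hn => by
    have hn' : (n : ℝ) ≠ 0 := by positivity
    have h1 := hiter (δ / n) n
    rw [mul_div_cancel₀ _ hn'] at h1
    refine le_trans (mul_le_mul_of_nonneg_right ?_ (hg θ)) h1
    have hc := Real.one_sub_sq_div_two_le_cos (x := δ / n)
    have hm : -1 ≤ Real.cos (δ / n) := Real.neg_one_le_cos _
    have hB := one_add_mul_le_pow (a := |Real.cos (δ / n)| - 1)
      (by linarith [abs_nonneg (Real.cos (δ / n))]) n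
    rw [add_sub_cancel] at hB
    refine le_trans ?_ hB
    have : 1 - (δ / n) ^ 2 / 2 ≤ |Real.cos (δ / n)| := hc.trans (le_abs_self _)
    calc 1 - δ ^ 2 / 2 * (n : ℝ)⁻¹ = 1 + n * (1 - (δ / n) ^ 2 / 2 - 1) := by field_simp; ring
      _ ≤ 1 + n * (|Real.cos (δ / n)| - 1) := by gcongr
  refine le_of_tendsto (f := fun n : ℕ => (1 - δ ^ 2 / 2 * (n : ℝ)⁻¹) * g θ)
    (x := Filter.atTop) ?_ (Filter.eventually_gt_atTop 0 |>.mono hbound)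
  simpa using ((tendsto_inv_atTop_nhds_zero_nat (𝕜 := ℝ)).const_mul (δ ^ 2 / 2)).const_sub 1
    |>.mul_const (g θ)

section NormedSpace

variable {X : Type*} [NormedAddCommGroup X] [NormedSpace ℝ X]

/-- If the Birkhoff orthogonality of a plane contains the orthogonality of a positive definite
diagonal form, then the norm is a multiple of the square root of that form. -/
theorem norm_sq_eq_of_diagonal_orthogonality (e f : X) {p q : ℝ} (hp : 0 < p) (hq : 0 < q)
    (h : ∀ a b u v : ℝ, p * a * u + q * b * v = 0 →
      ‖a • e + b • f‖ ≤ ‖a • e + b • f + (u • e + v • f)‖) :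
    ∃ k : ℝ, ∀ a b : ℝ, ‖a • e + b • f‖ ^ 2 = k * (p * a ^ 2 + q * b ^ 2) := by
  have hp' := (Real.sqrt_pos.2 hp).ne'
  have hq' := (Real.sqrt_pos.2 hq).ne'
  set r := √p with hr
  set s := √q with hs
  have hrp : p = r ^ 2 := (Real.sq_sqrt hp.le).symm
  have hsq : q = s ^ 2 := (Real.sq_sqrt hq.le).symm
  let c : ℝ → X := fun θ => (Real.cos θ / r) • e + (Real.sin θ / s) • f
  -- On the ellipse, `c (θ + δ)` is `cos δ • c θ` plus a vector conjugate to `c θ`.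
  have hrot : ∀ θ δ, |Real.cos δ| * ‖c θ‖ ≤ ‖c (θ + δ)‖ := fun θ δ => by
    have := h (Real.cos δ * (Real.cos θ / r)) (Real.cos δ * (Real.sin θ / s))
      (-(Real.sin δ * (Real.sin θ / r))) (Real.sin δ * (Real.cos θ / s)) (by
        rw [hrp, hsq]; field_simp; ring)
    calc |Real.cos δ| * ‖c θ‖ = ‖Real.cos δ • c θ‖ := by rw [norm_smul, Real.norm_eq_abs]
      _ = ‖(Real.cos δ * (Real.cos θ / r)) • e + (Real.cos δ * (Real.sin θ / s)) • f‖ := by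
        congr 1; simp only [c]; module
      _ ≤ _ := this
      _ = ‖c (θ + δ)‖ := by
        congr 1; simp only [c, Real.cos_add, Real.sin_add]; module
  have hconst := eq_of_abs_cos_mul_le (fun θ => ‖c θ‖) (fun _ => norm_nonneg _) hrot
  refine ⟨‖c 0‖ ^ 2, fun a b => ?_⟩
  let z : ℂ := ⟨r * a, s * b⟩
  have h1 : a • e + b • f = ‖z‖ • c z.arg := by
    have ha : ‖z‖ * Real.cos z.arg = r * a := Complex.norm_mul_cos_arg z
    have hb : ‖z‖ * Real.sin z.arg = s * b := Complex.norm_mul_sin_arg z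
    simp only [c, smul_add, smul_smul, mul_div_assoc', ha, hb]
    rw [mul_div_cancel_left₀ _ hp', mul_div_cancel_left₀ _ hq']
  rw [h1, norm_smul, norm_norm, mul_pow, hconst z.arg 0, ← Complex.normSq_eq_norm_sq,
    Complex.normSq_mk, hrp, hsq]
  ring

theorem parallelogram_of_diagonal_norm_sq {e f : X} {p q k : ℝ}
    (h : ∀ a b : ℝ, ‖a • e + b • f‖ ^ 2 = k * (p * a ^ 2 + q * b ^ 2)) (a b c d : ℝ) :
    ‖a • e + b • f + (c • e + d • f)‖ ^ 2 + ‖a • e + b • f - (c • e + d • f)‖ ^ 2 =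
      2 * (‖a • e + b • f‖ ^ 2 + ‖c • e + d • f‖ ^ 2) := by
  rw [show a • e + b • f + (c • e + d • f) = (a + c) • e + (b + d) • f by module,
    show a • e + b • f - (c • e + d • f) = (a - c) • e + (b - d) • f by module, h, h, h, h]
  ring

/-! ### Birkhoff orthogonality -/

/-- In a smooth space, Birkhoff orthogonality to `x` is the kernel of a functional. -/
theorem IsSmoothNormedSpace.exists_support_functional (hX : IsSmoothNormedSpace X) (x : X) :
    ∃ J : StrongDual ℝ X, J x = ‖x‖ ∧ ∀ y, J y = 0 ↔ ∀ t : ℝ, ‖x‖ ≤ ‖x + t • y‖ := by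
  rcases eq_or_ne x 0 with rfl | hx
  · exact ⟨0, by simp⟩
  have hx' : ‖x‖ ≠ 0 := norm_ne_zero_iff.2 hx
  obtain ⟨J, ⟨hJ, hJx⟩, huniq⟩ := hX (‖x‖⁻¹ • x) (norm_smul_inv_norm hx)
  have hJx' : J x = ‖x‖ := by
    rw [map_smul, smul_eq_mul] at hJx
    field_simp at hJx
    exact hJx
  refine ⟨J, hJx', fun y => ⟨fun hy t => ?_, fun hy => ?_⟩⟩
  · have := J.le_opNorm (x + t • y)
    rw [map_add, map_smul, hy, hJx', hJ, one_mul] at this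
    simpa using this
  -- Hahn–Banach modulo `y` yields a supporting functional that kills `y`; uniqueness identifies it
  -- with `J`.
  · let S := Submodule.span ℝ {y}
    have hnorm : ‖(Submodule.Quotient.mk x : X ⧸ S)‖ = ‖x‖ := by
      refine le_antisymm (Submodule.Quotient.norm_mk_le S x) ?_
      refine QuotientAddGroup.le_norm_iff.2 fun m hm => ?_
      obtain ⟨t, ht⟩ := Submodule.mem_span_singleton.1 ((Submodule.Quotient.eq S).1 hm)
      rw [show m = x + t • y by rw [ht]; abel]
      exact hy t
    obtain ⟨g, hg, hgx⟩ := exists_dual_vector'' ℝ (Submodule.Quotient.mk x : X ⧸ S)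
    let F : StrongDual ℝ X := (g.toLinearMap ∘ₗ S.mkQ).mkContinuous 1 fun z => by
      refine (g.le_of_opNorm_le hg _).trans ?_
      gcongr
      exact Submodule.Quotient.norm_mk_le S z
    have hF : ‖F‖ ≤ 1 := LinearMap.mkContinuous_norm_le _ zero_le_one _
    have hFx : F x = ‖x‖ := hgx.trans (by rw [hnorm]; rfl)
    have hFy : F y = 0 := by
      change g (Submodule.Quotient.mk y) = 0
      rw [(Submodule.Quotient.mk_eq_zero S).2 (Submodule.mem_span_singleton_self y), map_zero]
    have hF1 : ‖F‖ = 1 := hF.antisymm (by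
      have := F.le_opNorm x
      rw [hFx, norm_norm] at this
      exact (le_mul_iff_one_le_left (norm_pos_iff.2 hx)).1 this)
    rw [← huniq F ⟨hF1, by rw [map_smul, hFx, smul_eq_mul, inv_mul_cancel₀ hx']⟩, hFy]

/-- If best approximations out of lines are also best coapproximations, Birkhoff orthogonality is
symmetric. -/
theorem birkhoff_symm_of_approximation_eq_coapproximation [StrictConvexSpace ℝ X]
    (h : ∀ (x₀ : X) (G : Submodule ℝ X), Module.finrank ℝ G = 1 →
      ∃ w₀ : X, IsBestCoapproximation G x₀ w₀ ∧ IsBestApproximation G x₀ w₀)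
    {x y : X} (hxy : ∀ t : ℝ, ‖x‖ ≤ ‖x + t • y‖) (t : ℝ) : ‖y‖ ≤ ‖y + t • x‖ := by
  rcases eq_or_ne y 0 with rfl | hy
  · simp
  obtain ⟨w, ⟨hwG, hco⟩, -, hbest⟩ := h x (Submodule.span ℝ {y}) (finrank_span_singleton hy)
  have hw : w = 0 := by
    obtain ⟨c, rfl⟩ := Submodule.mem_span_singleton.1 hwG
    by_contra hne
    have h1 : ‖x - c • y‖ = ‖x‖ := by
      refine le_antisymm (by simpa using hbest 0 (zero_mem _)) ?_
      simpa [sub_eq_add_neg] using hxy (-c)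
    have h2 := norm_combo_lt_of_ne h1.le le_rfl (by simpa using hne) (one_half_pos (α := ℝ))
      (one_half_pos (α := ℝ)) (add_halves 1)
    have h3 := hxy (-(c / 2))
    refine (h3.trans_lt (lt_of_eq_of_lt ?_ h2)).false
    congr 1; module
  rcases eq_or_ne t 0 with rfl | ht
  · simp
  have h1 := hco (-(t⁻¹ • y)) (neg_mem (Submodule.smul_mem _ _ (Submodule.mem_span_singleton_self y)))
  rw [hw, zero_sub, neg_neg, sub_neg_eq_add] at h1
  have h2 := mul_le_mul_of_nonneg_left h1 (norm_nonneg t)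
  rw [← norm_smul, ← norm_smul, smul_add, smul_inv_smul₀ ht] at h2
  rwa [add_comm]

/-- **James, Day**: a smooth space of dimension at least three with symmetric Birkhoff
orthogonality satisfies the parallelogram law. -/
theorem parallelogram_of_birkhoff_symm (hX : IsSmoothNormedSpace X) (hdim : 3 ≤ Module.rank ℝ X)
    (hsymm : ∀ x y : X, (∀ t : ℝ, ‖x‖ ≤ ‖x + t • y‖) → ∀ t : ℝ, ‖y‖ ≤ ‖y + t • x‖) (x y : X) :
    ‖x + y‖ ^ 2 + ‖x - y‖ ^ 2 = 2 * (‖x‖ ^ 2 + ‖y‖ ^ 2) := by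
  choose J hJx hJ using hX.exists_support_functional
  have hJs : ∀ x y, J x y = 0 → J y x = 0 := fun x y h => (hJ _ _).2 (hsymm _ _ ((hJ _ _).1 h))
  have hker : ∀ φ ψ : StrongDual ℝ X, φ.toLinearMap.ker ⊓ ψ.toLinearMap.ker ≠ ⊥ := fun φ ψ h => by
    have hinj : Function.Injective (φ.toLinearMap.prod ψ.toLinearMap) := by
      rw [← LinearMap.ker_eq_bot, LinearMap.ker_prod, h]
    have h2 := LinearMap.lift_rank_le_of_injective _ hinj
    have h3 : Module.rank ℝ (ℝ × ℝ) = 2 := by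
      rw [← Module.finrank_eq_rank]; simp
    rw [h3, Cardinal.lift_ofNat, Cardinal.lift_le_ofNat_iff] at h2
    exact absurd (hdim.trans h2) (by norm_num)
  -- Allowing `v = 0` covers dependent `x`, `y` and the choice of a third vector.
  have hunit : ∀ φ ψ : StrongDual ℝ X, ∀ v, φ v = 0 → ψ v = 0 →
      ∃ e, v ∈ Submodule.span ℝ {e} ∧ φ e = 0 ∧ ψ e = 0 ∧ ‖e‖ = 1 := fun φ ψ v hφ hψ => by
    obtain ⟨w, ⟨hwφ, hwψ⟩, hw0, hvw⟩ : ∃ w ∈ φ.toLinearMap.ker ⊓ ψ.toLinearMap.ker, w ≠ 0 ∧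
        v ∈ Submodule.span ℝ {w} := by
      rcases eq_or_ne v 0 with rfl | hv
      · obtain ⟨w, hw, hw0⟩ := Submodule.exists_mem_ne_zero_of_ne_bot (hker φ ψ)
        exact ⟨w, hw, hw0, zero_mem _⟩
      · exact ⟨v, ⟨hφ, hψ⟩, hv, Submodule.mem_span_singleton_self v⟩
    have hwφ' : φ w = 0 := hwφ
    have hwψ' : ψ w = 0 := hwψ
    refine ⟨‖w‖⁻¹ • w, ?_, by simp [hwφ'], by simp [hwψ'], norm_smul_inv_norm hw0⟩
    rwa [Submodule.span_singleton_smul_eq (inv_ne_zero (norm_ne_zero_iff.2 hw0)).isUnit]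
  obtain ⟨e, hxe, -, -, he⟩ := hunit 0 0 x rfl rfl
  obtain ⟨f, hyf, hef, -, hf⟩ := hunit (J e) 0 (y - J e y • e) (by simp [hJx, he]) rfl
  obtain ⟨g, -, heg, hfg, hg⟩ := hunit (J e) (J f) 0 (map_zero _) (map_zero _)
  have hfe := hJs _ _ hef
  have hge := hJs _ _ heg
  have hgf := hJs _ _ hfg
  let V : ℝ → ℝ → ℝ → X := fun a b c => a • e + b • f + c • g
  have hV : ∀ (φ : StrongDual ℝ X) a b c, φ (V a b c) = φ e * a + φ f * b + φ g * c :=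
    fun φ a b c => by simp only [V, map_add, map_smul, smul_eq_mul]; ring
  have he1 : J e e = 1 := (hJx e).trans he
  have hf1 : J f f = 1 := (hJx f).trans hf
  have hg1 : J g g = 1 := (hJx g).trans hg
  have hVe : V 1 0 0 = e := by simp [V]
  have hVf : V 0 1 0 = f := by simp [V]
  have hVg : V 0 0 1 = g := by simp [V]
  obtain ⟨p, q, hp, hq, hpq⟩ := exists_diagonal_form_of_symmetric_relation
    (fun a b c => J (V a b c) e) (fun a b c => J (V a b c) f) (fun a b c => J (V a b c) g)
    (fun a b c u v w h => by rw [← hV] at h ⊢; exact hJs _ _ h)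
    (fun a b c h => by
      rw [← hV, hJx, norm_eq_zero] at h
      refine ⟨?_, ?_, ?_⟩
      · simpa [h, he1, hef, heg] using (hV (J e) a b c).symm
      · simpa [h, hf1, hfe, hfg] using (hV (J f) a b c).symm
      · simpa [h, hg1, hge, hgf] using (hV (J g) a b c).symm)
    (by simp only [hVe]; exact ⟨he1, hef, heg⟩) (by simp only [hVf]; exact ⟨hfe, hf1, hfg⟩)
    (by simp only [hVg]; exact ⟨hge, hgf, hg1⟩)
  obtain ⟨k, hk⟩ := norm_sq_eq_of_diagonal_orthogonality e f hp hq fun a b u v h => by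
    have h1 := hpq a b u v h
    have h2 : J (V a b 0) (V u v 0) = 0 := by rw [hV]; linear_combination h1
    simpa [V] using (hJ _ _).1 h2 1
  obtain ⟨a, rfl⟩ := Submodule.mem_span_singleton.1 hxe
  obtain ⟨d, hd⟩ := Submodule.mem_span_singleton.1 hyf
  have hy : y = J e y • e + d • f := by rw [hd]; abel
  rw [hy]
  simpa using parallelogram_of_diagonal_norm_sq hk a 0 (J e y) d

theorem isRealInnerProductSpace_of_approximation_eq_coapproximation [StrictConvexSpace ℝ X]
    (hX : IsSmoothNormedSpace X) (hdim : 3 ≤ Module.rank ℝ X)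
    (h : ∀ (x₀ : X) (G : Submodule ℝ X), Module.finrank ℝ G = 1 →
      ∃ w₀ : X, IsBestCoapproximation G x₀ w₀ ∧ IsBestApproximation G x₀ w₀) :
    IsRealInnerProductSpace X := by
  refine ⟨InnerProductSpace.ofNorm ℝ fun x y => ?_, rfl⟩
  simpa only [sq] using parallelogram_of_birkhoff_symm hX hdim
    (fun x y => birkhoff_symm_of_approximation_eq_coapproximation h) x y

end NormedSpace

/-! ### Projections in inner product spaces -/

section InnerProductSpace

variable {X : Type*} [NormedAddCommGroup X] [I : InnerProductSpace ℝ X]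

/-- The orthogonal projection is the only best coapproximation and the only best
approximation. -/
theorem exists_unique_best_approximation_and_coapproximation (x₀ : X) (G : Submodule ℝ X)
    [G.HasOrthogonalProjection] :
    ∃ w, IsBestCoapproximation G x₀ w ∧ IsBestApproximation G x₀ w ∧
      (∀ v, IsBestCoapproximation G x₀ v → v = w) ∧ ∀ v, IsBestApproximation G x₀ v → v = w := by
  set w := G.starProjection x₀ with hw
  have hwG : w ∈ G := G.starProjection_apply_mem x₀
  have hpyth : ∀ g ∈ G, ‖x₀ - g‖ ^ 2 = ‖x₀ - w‖ ^ 2 + ‖w - g‖ ^ 2 := fun g hg => by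
    have := norm_add_sq_eq_norm_sq_add_norm_sq_real (x := x₀ - w) (y := w - g)
      (G.starProjection_inner_eq_zero x₀ _ (sub_mem hwG hg))
    rw [sub_add_sub_cancel] at this
    linarith
  refine ⟨w, ⟨hwG, fun g hg => ?_⟩, ⟨hwG, fun g hg => ?_⟩, fun v hv => ?_, fun v hv => ?_⟩
  · exact (sq_le_sq₀ (norm_nonneg _) (norm_nonneg _)).1 (by
      rw [hpyth g hg]; exact le_add_of_nonneg_left (sq_nonneg _))
  · exact (sq_le_sq₀ (norm_nonneg _) (norm_nonneg _)).1 (by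
      rw [hpyth g hg]; exact le_add_of_nonneg_right (sq_nonneg _))
  · by_contra hne
    have hd : 0 < ‖v - w‖ := norm_pos_iff.2 (sub_ne_zero.2 hne)
    -- Testing beyond `w`, away from `v`, cancels `s ^ 2` and leaves a bound linear in `s`, absurd
    -- for large `s`.
    have key : ∀ s : ℝ, 0 ≤ s → (1 + 2 * s) * ‖v - w‖ ^ 2 ≤ ‖x₀ - w‖ ^ 2 := fun s hs => by
      have hg : w - s • (v - w) ∈ G := sub_mem hwG (G.smul_mem _ (sub_mem hv.1 hwG))
      have h1 := pow_le_pow_left₀ (norm_nonneg _) (hv.2 _ hg) 2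
      rw [hpyth _ hg, sub_sub_cancel, show v - (w - s • (v - w)) = (1 + s) • (v - w) by module,
        norm_smul, norm_smul, mul_pow, mul_pow, Real.norm_eq_abs, Real.norm_eq_abs, sq_abs,
        sq_abs] at h1
      linarith
    have h1 := key (‖x₀ - w‖ ^ 2 / ‖v - w‖ ^ 2) (by positivity)
    rw [add_mul, mul_assoc, div_mul_cancel₀ _ (by positivity)] at h1
    nlinarith [sq_nonneg ‖x₀ - w‖, pow_pos hd 2]
  · have h1 := pow_le_pow_left₀ (norm_nonneg _) (hv.2 w hwG) 2
    rw [hpyth v hv.1] at h1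
    have h2 : ‖w - v‖ ^ 2 = 0 := le_antisymm (by linarith) (sq_nonneg _)
    exact (sub_eq_zero.1 (norm_eq_zero.1 (pow_eq_zero_iff two_ne_zero |>.1 h2))).symm

end InnerProductSpace

theorem theorem2p4 {X : Type*} [NormedAddCommGroup X] [NormedSpace ℝ X]
    (hsmooth : IsSmoothNormedSpace X) (hconvex : StrictConvexSpace ℝ X)
    (hdim : 3 ≤ Module.rank ℝ X) :
    (IsRealInnerProductSpace X ↔
      ∀ (x₀ : X) (G : Submodule ℝ X), Module.finrank ℝ G = 1 →
        ∃ w₀ : X, IsBestCoapproximation G x₀ w₀ ∧ IsBestApproximation G x₀ w₀) ∧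
    (IsRealInnerProductSpace X →
      ∀ (x₀ : X) (G : Submodule ℝ X), Module.finrank ℝ G = 1 →
        (∃! w₀ : X, IsBestCoapproximation G x₀ w₀) ∧
          (∃! g₀ : X, IsBestApproximation G x₀ g₀)) := by
  have main : IsRealInnerProductSpace X → ∀ (x₀ : X) (G : Submodule ℝ X),
      Module.finrank ℝ G = 1 → ∃ w, IsBestCoapproximation G x₀ w ∧ IsBestApproximation G x₀ w ∧
        (∀ v, IsBestCoapproximation G x₀ v → v = w) ∧
        ∀ v, IsBestApproximation G x₀ v → v = w := by
    clear hsmooth hconvex hdim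
    rintro ⟨I, rfl⟩ x₀ G hG
    have : FiniteDimensional ℝ G := Module.finite_of_finrank_eq_succ hG
    exact exists_unique_best_approximation_and_coapproximation x₀ G
  refine ⟨⟨fun h x₀ G hG => ?_,
    isRealInnerProductSpace_of_approximation_eq_coapproximation hsmooth hdim⟩,
    fun h x₀ G hG => ?_⟩
  · obtain ⟨w, hco, happ, -⟩ := main h x₀ G hG
    exact ⟨w, hco, happ⟩
  · obtain ⟨w, hco, happ, hco', happ'⟩ := main h x₀ G hG
    exact ⟨⟨w, hco, hco'⟩, ⟨w, happ, happ'⟩⟩
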